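/- Let $N\ge 1$ and $n\ge 1$, let $d_0,\dots,d_N$ be layer widths, and let $X\in\mathbb{R}^{d_0\times n}$, $Y\in\mathbb{R}^{d_N\times n}$. The squared-loss training problem of the $N$-layer linear network is $$\inf_{W_1,\dots,W_N}\ \frac{1}{2n}\,\|W_NW_{N-1}\cdots W_1X-Y\|_F^2,\qquad W_k\in\mathbb{R}^{d_k\times d_{k-1}}. \tag{1}$$ Put $d:=d_N+d_0$, $r:=\min_{0\le k\le N}d_k$, and $$P_u=\begin{bmatrix}I_{d_N}\\0\end{bmatrix}\in\mathbb{R}^{d\times d_N},\qquad P_v=\begin{bmatrix}0\\I_{d_0}\end{bmatrix}\in\mathbb{R}^{d\times d_0}.$$ Let $\operatorname{vec}$ stack the columns of a matrix, let $\operatorname{mat}$ be its inverse, let $\mathbb{S}_+^d$ be the cone of symmetric positive semidefinite $d\times d$ matrices, and let $\widehat{\mathbb{K}}:=\mathbb{R}_+\times\operatorname{vec}(\mathbb{S}_+^d)\times\operatorname{vec}(\mathbb{S}_+^d)\times\operatorname{vec}(\mathbb{S}_+^d)\subset\mathbb{R}^{1+3d^2}$. For a cone $\mathbb{K}\subset\mathbb{R}^p$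 let $\mathcal{CP}_{\mathbb{K}}:=\operatorname{conv}\{zz^\top : z\in\mathbb{K}\}$. Inner products of matrices are $\langle A,B\rangle=\operatorname{tr}(A^\top B)$. Consider the following program in the variables $z_i\in\mathbb{R}^{d^2}$ and $Z_{ij}\in\mathbb{R}^{d^2\times d^2}$, $i,j\in\{1,2,3\}$: $$ \begin{aligned} \inf_{z_i,\,Z_{ij}}\quad & \frac{1}{2n}\Big(\langle P_vXX^\top P_v^\top\otimes P_uP_u^\top,\,Z_{11}\rangle-2\,\langle\operatorname{vec}(P_uYX^\top P_v^\top),\,z_1\rangle+\|Y\|_F^2\Big)\\ \text{s.t.}\quad & \operatorname{tr}(\operatorname{mat}(z_2))=r,\\ & \langle\operatorname{vec}(I_d)\operatorname{vec}(I_d)^\top,\,Z_{22}\rangle=r^2,\\ & z_2+z_3=\operatorname{vec}(I_d),\\ & \operatorname{diag}(Z_{22}+Z_{23}+Z_{32}+Z_{33})=\operatorname{vec}(I_d),\\ & \operatorname{tr}(\operatorname{mat}(z_1))-\operatorname{tr}(Z_{12})\le 0,\\ & \begin{bmatrix}1&z_1^\top&z_2^\top&z_3^\top\\ z_1&Z_{11}&Z_{12}&Z_{13}\\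 z_2&Z_{21}&Z_{22}&Z_{23}\\ z_3&Z_{31}&Z_{32}&Z_{33}\end{bmatrix}\in\mathcal{CP}_{\widehat{\mathbb{K}}}. \end{aligned}\tag{2} $$ Then (2) is a convex program: its feasible set is convex and its objective is affine in the variables $(z_i,Z_{ij})$. Its block matrix has order $1+3d^2$. Problems (1) and (2) have the same optimal value, that is, the infimum of (1) and the infimum of (2) over its feasible set are the same real number. -/

import Mathlib

open Matrix
open scoped Kronecker

/-! ### Training a linear network -/

/-- The inner product `⟨A, B⟩ = ∑ i, ∑ j, A i j * B i j` of two matrices. -/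
def frobInner {m n : Type*} [Fintype m] [Fintype n] (A B : Matrix m n ℝ) : ℝ :=
  ∑ i, ∑ j, A i j * B i j

/-- The squared Frobenius norm. -/
def frobSq {m n : Type*} [Fintype m] [Fintype n] (A : Matrix m n ℝ) : ℝ :=
  ∑ i, ∑ j, A i j ^ 2

/-- Weights of a linear network with `N` layers and widths `d 0, …, d N`. The entry with index
`k < N` is the matrix of layer `k + 1`, of size `d (k + 1) × d k`. -/
abbrev LayerWeights (d : ℕ → ℕ) (N : ℕ) : Type :=
  (k : Fin N) → Matrix (Fin (d (k + 1))) (Fin (d k)) ℝ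

/-- The end-to-end matrix `W_N * ⋯ * W_1`. -/
def endToEnd (d : ℕ → ℕ) : (N : ℕ) → LayerWeights d N → Matrix (Fin (d N)) (Fin (d 0)) ℝ
  | 0, _ => 1
  | N + 1, W =>
    let top : Matrix (Fin (d (N + 1))) (Fin (d N)) ℝ := W (Fin.last N)
    top * endToEnd d N (fun k => W k.castSucc)

/-- The squared training loss `(1 / 2n) ‖W_N ⋯ W_1 X - Y‖_F²`. -/
noncomputable def trainingLoss {n : ℕ} (d : ℕ → ℕ) (N : ℕ) (X : Matrix (Fin (d 0)) (Fin n) ℝ)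
    (Y : Matrix (Fin (d N)) (Fin n) ℝ) (W : LayerWeights d N) : ℝ :=
  1 / (2 * (n : ℝ)) * frobSq (endToEnd d N W * X - Y)

/-- The smallest of the widths `d 0, …, d N`. -/
def minWidth (d : ℕ → ℕ) (N : ℕ) : ℕ :=
  (Finset.range (N + 1)).inf' Finset.nonempty_range_add_one d

/-! ### The completely positive program -/

/-- The inverse of the column-stacking map `Matrix.vec`. -/
def unvec {m n : Type*} (x : n × m → ℝ) : Matrix m n ℝ :=
  Matrix.of fun i j => x (j, i)

theorem vec_unvec {m n : Type*} (x : n × m → ℝ) : vec (unvec x) = x := rfl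

theorem unvec_vec {m n : Type*} (A : Matrix m n ℝ) : unvec (vec A) = A := rfl

/-- The `K`-completely positive cone of a cone `K ⊆ ℝ^ι`: the convex hull of all `z zᵀ`
with `z ∈ K`. -/
def completelyPositiveCone {ι : Type*} (K : Set (ι → ℝ)) : Set (Matrix ι ι ℝ) :=
  convexHull ℝ {M | ∃ z ∈ K, M = vecMulVec z z}

/-- Index set of `ℝ × ℝ^(m × m) × ℝ^(m × m) × ℝ^(m × m)`. -/
abbrev LiftedIndex (m : Type*) : Type _ := Unit ⊕ (Fin 3 × (m × m))

/-- The cone `ℝ₊ × vec(S₊) × vec(S₊) × vec(S₊)`. -/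
def liftedCone (m : Type*) [Fintype m] : Set (LiftedIndex m → ℝ) :=
  {x | 0 ≤ x (Sum.inl ()) ∧
    ∀ i : Fin 3, (fun a => x (Sum.inr (i, a))) ∈ vec '' {A : Matrix m m ℝ | A.PosSemidef}}

/-- The variables `(z_i, Z_ij)`, `i, j = 1, 2, 3`. The index `i` is represented by
`i - 1 : Fin 3`. -/
abbrev LiftedVars (m : Type*) : Type _ :=
  (Fin 3 → m × m → ℝ) × (Fin 3 → Fin 3 → Matrix (m × m) (m × m) ℝ)

/-- The block matrix with top left entry `1`, first row and column given by the `z_i`, and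
remaining blocks `Z_ij`. -/
def blockMatrix {m : Type*} (p : LiftedVars m) : Matrix (LiftedIndex m) (LiftedIndex m) ℝ :=
  Matrix.fromBlocks 1 (Matrix.of fun _ a => p.1 a.1 a.2) (Matrix.of fun a _ => p.1 a.1 a.2)
    (Matrix.of fun a b => p.2 a.1 b.1 a.2 b.2)

/-- The feasible set of the completely positive program with trace parameter `r`. -/
def cpFeasible (m : Type*) [Fintype m] [DecidableEq m] (r : ℝ) : Set (LiftedVars m) :=
  {p |
    (unvec (p.1 1)).trace = r ∧
    frobInner (vecMulVec (vec (1 : Matrix m m ℝ)) (vec (1 : Matrix m m ℝ))) (p.2 1 1) = r ^ 2 ∧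
    p.1 1 + p.1 2 = vec (1 : Matrix m m ℝ) ∧
    (p.2 1 1 + p.2 1 2 + p.2 2 1 + p.2 2 2).diag = vec (1 : Matrix m m ℝ) ∧
    (unvec (p.1 0)).trace - (p.2 0 1).trace ≤ 0 ∧
    blockMatrix p ∈ completelyPositiveCone (liftedCone m)}

/-- The selection matrix `P_u`, an identity block above a zero block. -/
def selU (a b : ℕ) : Matrix (Fin a ⊕ Fin b) (Fin a) ℝ := Matrix.fromRows 1 0

/-- The selection matrix `P_v`, a zero block above an identity block. -/
def selV (a b : ℕ) : Matrix (Fin a ⊕ Fin b) (Fin b) ℝ := Matrix.fromRows 0 1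

/-- The objective of the completely positive program, for output dimension `a`, input dimension
`b`, and `n` data points. Coordinates of `ℝ^(a + b)` are indexed by `Fin a ⊕ Fin b`. -/
noncomputable def cpObjective {a b n : ℕ} (X : Matrix (Fin b) (Fin n) ℝ)
    (Y : Matrix (Fin a) (Fin n) ℝ) (p : LiftedVars (Fin a ⊕ Fin b)) : ℝ :=
  1 / (2 * (n : ℝ)) *
    (frobInner ((selV a b * X * Xᵀ * (selV a b)ᵀ) ⊗ₖ (selU a b * (selU a b)ᵀ)) (p.2 0 0)
      - 2 * (vec (selU a b * Y * Xᵀ * (selV a b)ᵀ) ⬝ᵥ p.1 0)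
      + frobSq Y)

/-!
The first problem is the minimization of `‖M X - Y‖²` over the matrices `M` that factor through
`ℝ ^ r`, `r` the smallest width: an end-to-end matrix factors through each layer, and conversely
every product through `ℝ ^ r` is realized by embedding `ℝ ^ r` isometrically into the hidden layers
(`factorsThrough_endToEnd`, `exists_endToEnd_of_factorsThrough`).

Given such an `M = L R`, the matrix `A = S Sᵀ` with `S` stacking `L` and `Rᵀ` is semidefinite of
rank at most `r` and has `M` as its off-diagonal block. With an orthogonal projection `V` of rank
`r` that fixes `A`, the vector `(1, vec A, vec V, vec (1 - V))` gives a rank-one feasible point whose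
objective value is the training loss (`exists_mem_cpFeasible`).

Conversely, a feasible block matrix is a sum of terms `z zᵀ` with components `(ζ, A, V, T)` and
`∑ ζ² = 1`. The constraints pair first and second moments of linear functions of these components
in the equality case of the Cauchy–Schwarz inequality (`eq_mul_of_sum_sq_eq`), so each term
satisfies `tr V = r ζ` and `V + T = ζ I`. The last constraint becomes `∑ tr (A T) ≤ 0`, hence
`T A = 0` and `V A = ζ A` in each term. If `ζ > 0`, then `A` maps into the `ζ`-eigenspace of `V`,
which has dimension at most `tr V / ζ = r`. The objective is the sum of the
`‖A_uv X - ζ Y‖² / (2n)`, where `A_uv` is the off-diagonal block of `A` (`cpObjective_eq_sum`). Each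
term is therefore `ζ²` times a training loss if `ζ > 0`, and nonnegative if `ζ = 0`, a case in which
`A` is unconstrained; so the sum is at least the infimum of the training loss (`le_cpObjective`).
-/

/-! ### Matrices of low rank and semidefinite matrices -/

/-- `M` factors through `ℝ ^ r`. Over a field this says that `M` has rank at most `r`. -/
def FactorsThrough {m n : Type*} (r : ℕ) (M : Matrix m n ℝ) : Prop :=
  ∃ (L : Matrix m (Fin r) ℝ) (R : Matrix (Fin r) n ℝ), M = L * R

theorem exists_transpose_mul_self_eq_one {α β : Type*} [Fintype α] [Fintype β] [DecidableEq α]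
    (h : Fintype.card α ≤ Fintype.card β) : ∃ J : Matrix β α ℝ, Jᵀ * J = 1 := by
  classical
  obtain ⟨g⟩ := Function.Embedding.nonempty_of_card_le h
  refine ⟨(1 : Matrix β β ℝ).submatrix id g, ?_⟩
  have h1 := submatrix_mul_equiv (1 : Matrix β β ℝ) (1 : Matrix β β ℝ) g (Equiv.refl β) g
  rw [Matrix.one_mul, submatrix_one_embedding] at h1
  rw [transpose_submatrix, transpose_one]
  exact h1

theorem factorsThrough_of_mul {m n α : Type*} [Fintype α] {r : ℕ} (h : Fintype.card α ≤ r)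
    (L : Matrix m α ℝ) (R : Matrix α n ℝ) : FactorsThrough r (L * R) := by
  classical
  obtain ⟨J, hJ⟩ := exists_transpose_mul_self_eq_one (α := α) (β := Fin r) (by simpa using h)
  exact ⟨L * Jᵀ, J * R, by rw [Matrix.mul_assoc, ← Matrix.mul_assoc Jᵀ, hJ, Matrix.one_mul]⟩

theorem FactorsThrough.mul_left {l m n : Type*} [Fintype m] {r : ℕ} {M : Matrix m n ℝ}
    (h : FactorsThrough r M) (P : Matrix l m ℝ) : FactorsThrough r (P * M) := by
  obtain ⟨L, R, rfl⟩ := h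
  exact ⟨P * L, R, (Matrix.mul_assoc _ _ _).symm⟩

theorem FactorsThrough.mul_right {m n o : Type*} [Fintype n] {r : ℕ} {M : Matrix m n ℝ}
    (h : FactorsThrough r M) (P : Matrix n o ℝ) : FactorsThrough r (M * P) := by
  obtain ⟨L, R, rfl⟩ := h
  exact ⟨L, R * P, Matrix.mul_assoc _ _ _⟩

theorem FactorsThrough.smul {m n : Type*} {r : ℕ} {M : Matrix m n ℝ}
    (h : FactorsThrough r M) (c : ℝ) : FactorsThrough r (c • M) := by
  obtain ⟨L, R, rfl⟩ := h
  exact ⟨c • L, R, (Matrix.smul_mul _ _ _).symm⟩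

section PosSemidef

variable {m : Type*} [Fintype m] {A B : Matrix m m ℝ}

open scoped MatrixOrder Matrix.Norms.L2Operator in
/-- The trace of `A * B` is the squared Frobenius norm of `D * Cᵀ`, where `A = Cᵀ * C` and
`B = Dᵀ * D`. This gives both its sign and the case where it vanishes. -/
theorem trace_mul_nonneg_and_mul_eq_zero (hA : A.PosSemidef) (hB : B.PosSemidef) :
    0 ≤ (A * B).trace ∧ ((A * B).trace = 0 → B * A = 0) := by
  classical
  obtain ⟨C, rfl⟩ := CStarAlgebra.nonneg_iff_eq_star_mul_self.mp hA.nonneg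
  obtain ⟨D, rfl⟩ := CStarAlgebra.nonneg_iff_eq_star_mul_self.mp hB.nonneg
  simp only [star_eq_conjTranspose]
  have key : (Cᴴ * C * (Dᴴ * D)).trace = ((D * Cᴴ)ᴴ * (D * Cᴴ)).trace := by
    rw [conjTranspose_mul, conjTranspose_conjTranspose, Matrix.mul_assoc, trace_mul_comm]
    simp only [Matrix.mul_assoc]
  rw [key]
  refine ⟨(posSemidef_conjTranspose_mul_self _).trace_nonneg, fun h => ?_⟩
  have h0 := trace_conjTranspose_mul_self_eq_zero_iff.mp h
  rw [Matrix.mul_assoc, ← Matrix.mul_assoc D, h0, Matrix.zero_mul, Matrix.mul_zero]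

/-- If `V * A = ζ • A`, the columns of `A` lie in the `ζ`-eigenspace of `V`, whose dimension is at
most `r` because the eigenvalues of `V` are nonnegative and sum to `r * ζ`. -/
theorem factorsThrough_of_mul_eq_smul {V : Matrix m m ℝ} (hV : V.PosSemidef) {ζ : ℝ} (hζ : 0 < ζ)
    {r : ℕ} (htr : V.trace = r * ζ) (hVA : V * A = ζ • A) : FactorsThrough r A := by
  classical
  set U : Matrix m m ℝ := ↑hV.1.eigenvectorUnitary
  have hUU : U * star U = 1 := Unitary.coe_mul_star_self _
  have hUU' : star U * U = 1 := Unitary.coe_star_mul_self _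
  set e := hV.1.eigenvalues
  have hspec : V = U * diagonal e * star U := by
    have := hV.1.spectral_theorem
    rw [Unitary.conjStarAlgAut_apply] at this
    simpa using! this
  have hrow : ∀ i j, e i ≠ ζ → (star U * A) i j = 0 := by
    intro i j hi
    have h1 : diagonal e * (star U * A) = ζ • (star U * A) := by
      rw [← Matrix.mul_smul, ← hVA, hspec]
      simp only [← Matrix.mul_assoc, hUU', Matrix.one_mul]
    have h2 := congrFun (congrFun h1 i) j
    rw [diagonal_mul, Matrix.smul_apply, smul_eq_mul] at h2
    have h3 : (e i - ζ) * (star U * A) i j = 0 := by linarith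
    exact (mul_eq_zero.mp h3).resolve_left (sub_ne_zero.mpr hi)
  have hcard : Fintype.card {i // e i = ζ} ≤ r := by
    have h1 : V.trace = ∑ i, e i := by simpa using hV.1.trace_eq_sum_eigenvalues
    have h2 : ∑ i with e i = ζ, e i ≤ ∑ i, e i :=
      Finset.sum_le_sum_of_subset_of_nonneg (Finset.filter_subset _ _)
        fun i _ _ => hV.eigenvalues_nonneg i
    have h3 : ∑ i with e i = ζ, e i = (Fintype.card {i // e i = ζ} : ℝ) * ζ := by
      rw [Finset.sum_congr rfl (fun i hi => (Finset.mem_filter.mp hi).2), Finset.sum_const,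
        nsmul_eq_mul, Fintype.card_subtype]
    rw [h3, ← h1, htr] at h2
    exact_mod_cast le_of_mul_le_mul_right h2 hζ
  have hA : A = U.submatrix id (Subtype.val : {i // e i = ζ} → m) *
      (star U * A).submatrix Subtype.val id := by
    ext i j
    calc A i j = (U * (star U * A)) i j := by rw [← Matrix.mul_assoc, hUU, Matrix.one_mul]
      _ = ∑ k, U i k * (star U * A) k j := mul_apply
      _ = ∑ k : {i // e i = ζ}, U i k * (star U * A) k j := ?_
    rw [← Finset.sum_subtype (Finset.univ.filter fun i => e i = ζ) (by simp)
      (fun k => U i k * (star U * A) k j)]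
    refine (Finset.sum_filter_of_ne fun k _ hk => ?_).symm
    by_contra h
    exact hk (by rw [hrow k j h, mul_zero])
  rw [hA]
  exact factorsThrough_of_mul hcard _ _

/-- A semidefinite matrix of rank at most `r` is fixed by an orthogonal projection of rank exactly
`r`: the projection onto the span of `r` eigenvectors that include all those with nonzero
eigenvalue. -/
theorem exists_projection_of_rank_le [DecidableEq m] (hA : A.PosSemidef) {r : ℕ} (hr : A.rank ≤ r)
    (hrm : r ≤ Fintype.card m) :
    ∃ V : Matrix m m ℝ, V.PosSemidef ∧ (1 - V).PosSemidef ∧ V.trace = r ∧ A * V = A := by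
  set U : Matrix m m ℝ := ↑hA.1.eigenvectorUnitary
  have hUU : U * star U = 1 := Unitary.coe_mul_star_self _
  have hUU' : star U * U = 1 := Unitary.coe_star_mul_self _
  set e := hA.1.eigenvalues
  have hspec : A = U * diagonal e * star U := by
    have := hA.1.spectral_theorem
    rw [Unitary.conjStarAlgAut_apply] at this
    simpa using! this
  obtain ⟨S, hS, hSr⟩ : ∃ S : Finset m, (Finset.univ.filter fun i => e i ≠ 0) ⊆ S ∧ S.card = r := by
    obtain ⟨S, h1, -, h3⟩ := Finset.exists_subsuperset_card_eq
      (Finset.subset_univ (Finset.univ.filter fun i => e i ≠ 0)) (n := r)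
      (by rwa [← Fintype.card_subtype, ← hA.1.rank_eq_card_non_zero_eigs]) (by simpa using hrm)
    exact ⟨S, h1, h3⟩
  set w : m → ℝ := fun i => if i ∈ S then 1 else 0 with hw
  refine ⟨U * diagonal w * Uᴴ, ?_, ?_, ?_, ?_⟩
  · refine (PosSemidef.diagonal fun i => ?_).mul_mul_conjTranspose_same U
    by_cases h : i ∈ S <;> simp [hw, h]
  · have h1 : 1 - U * diagonal w * Uᴴ = U * diagonal (1 - w) * Uᴴ := by
      have : diagonal (1 - w) = 1 - diagonal w := by
        rw [← diagonal_one, diagonal_sub]; rfl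
      rw [this, Matrix.mul_sub, Matrix.sub_mul, Matrix.mul_one, ← star_eq_conjTranspose, hUU]
    rw [h1]
    refine (PosSemidef.diagonal fun i => ?_).mul_mul_conjTranspose_same U
    by_cases h : i ∈ S <;> simp [hw, h]
  · rw [Matrix.mul_assoc, trace_mul_comm, Matrix.mul_assoc, ← star_eq_conjTranspose, hUU',
      Matrix.mul_one, trace_diagonal]
    simp [hw, hSr]
  · have h1 : diagonal e * diagonal w = diagonal e := by
      rw [diagonal_mul_diagonal]
      congr 1
      ext i
      by_cases h : i ∈ S
      · simp [hw, h]
      · have : e i = 0 := by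
          by_contra h0
          exact h (hS (by simpa using h0))
        simp [this]
    rw [← star_eq_conjTranspose]
    conv_rhs => rw [hspec, ← h1]
    conv_lhs => rw [hspec]
    simp only [Matrix.mul_assoc]
    rw [← Matrix.mul_assoc (star U) U, hUU', Matrix.one_mul]

end PosSemidef

/-! ### End-to-end matrices of linear networks -/

theorem factorsThrough_endToEnd (d : ℕ → ℕ) (N : ℕ) (W : LayerWeights d N) {k : ℕ} (hk : k ≤ N) :
    FactorsThrough (d k) (endToEnd d N W) := by
  induction N with
  | zero =>
    obtain rfl : k = 0 := by omega
    exact ⟨1, endToEnd d 0 W, (Matrix.one_mul _).symm⟩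
  | succ N ih =>
    rcases Nat.lt_or_ge N k with h | h
    · obtain rfl : k = N + 1 := by omega
      exact ⟨1, endToEnd d (N + 1) W, (Matrix.one_mul _).symm⟩
    · exact (ih (fun k => W k.castSucc) h).mul_left _

/-- A product through `ℝ ^ r` is realized by embedding `ℝ ^ r` isometrically into each hidden
layer. -/
theorem exists_endToEnd_eq_mul (d : ℕ → ℕ) (r N : ℕ) (hN : 1 ≤ N) (hr : ∀ k ≤ N, r ≤ d k)
    (L : Matrix (Fin (d N)) (Fin r) ℝ) (R : Matrix (Fin r) (Fin (d 0)) ℝ) :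
    ∃ W : LayerWeights d N, endToEnd d N W = L * R := by
  induction N, hN using Nat.le_induction with
  | base =>
    refine ⟨fun k => (Subsingleton.elim 0 k) ▸ (L * R), ?_⟩
    simp only [endToEnd, Matrix.mul_one]
  | succ N hN ih =>
    obtain ⟨J, hJ⟩ := exists_transpose_mul_self_eq_one (α := Fin r) (β := Fin (d N))
      (by simpa using hr N (by omega))
    obtain ⟨W, hW⟩ := ih (fun k hk => hr k (by omega)) J
    refine ⟨Fin.snoc (α := fun k : Fin (N + 1) => Matrix (Fin (d (k + 1))) (Fin (d k)) ℝ) W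
      (L * Jᵀ : Matrix (Fin (d (N + 1))) (Fin (d N)) ℝ), ?_⟩
    simp only [endToEnd, Fin.snoc_last, Fin.snoc_castSucc]
    rw [hW]
    rw [Matrix.mul_assoc, ← Matrix.mul_assoc Jᵀ, hJ, Matrix.one_mul]

theorem exists_width_eq_minWidth (d : ℕ → ℕ) (N : ℕ) : ∃ k ≤ N, d k = minWidth d N := by
  obtain ⟨k, hk, h⟩ := Finset.exists_mem_eq_inf' (s := Finset.range (N + 1))
    Finset.nonempty_range_add_one d
  exact ⟨k, by simpa [Nat.lt_succ_iff] using hk, h.symm⟩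

theorem minWidth_le (d : ℕ → ℕ) {N k : ℕ} (hk : k ≤ N) : minWidth d N ≤ d k :=
  Finset.inf'_le d (Finset.mem_range.mpr (by omega))

theorem exists_endToEnd_of_factorsThrough (d : ℕ → ℕ) {N : ℕ} (hN : 1 ≤ N)
    {M : Matrix (Fin (d N)) (Fin (d 0)) ℝ} (h : FactorsThrough (minWidth d N) M) :
    ∃ W : LayerWeights d N, endToEnd d N W = M := by
  obtain ⟨L, R, rfl⟩ := h
  exact exists_endToEnd_eq_mul d _ N hN (fun k hk => minWidth_le d hk) L R

/-! ### Decomposing points of the completely positive program -/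

/-- A point of the completely positive program is a sum of rank-one terms with components
`ζ k ≥ 0` and `B k i` positive semidefinite. The convex weights are absorbed into these components,
as the cone is closed under multiplication by nonnegative scalars. -/
theorem exists_decomposition {m : Type*} [Fintype m] {p : LiftedVars m}
    (h : blockMatrix p ∈ completelyPositiveCone (liftedCone m)) :
    ∃ (ι : Type) (_ : Fintype ι) (ζ : ι → ℝ) (B : ι → Fin 3 → Matrix m m ℝ),
      (∀ k, 0 ≤ ζ k) ∧ (∀ k i, (B k i).PosSemidef) ∧ ∑ k, ζ k ^ 2 = 1 ∧
      (∀ i, p.1 i = ∑ k, ζ k • vec (B k i)) ∧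
      ∀ i j, p.2 i j = ∑ k, vecMulVec (vec (B k i)) (vec (B k j)) := by
  rw [completelyPositiveCone, mem_convexHull_iff_exists_fintype] at h
  obtain ⟨ι, _, w, M, hw, hw1, hM, hp⟩ := h
  choose z hz hMz using hM
  choose hz0 A hA hAz using hz
  have hs : ∀ k, √(w k) * √(w k) = w k := fun k => Real.mul_self_sqrt (hw k)
  have hvec : ∀ k i a, z k (Sum.inr (i, a)) = vec (A k i) a := fun k i a =>
    (congrFun (hAz k i) a).symm
  have hentry : ∀ x y, blockMatrix p x y = ∑ k, w k * (z k x * z k y) := fun x y => by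
    rw [← hp, Matrix.sum_apply]
    exact Finset.sum_congr rfl fun k _ => by rw [hMz k]; rfl
  refine ⟨ι, inferInstance, fun k => √(w k) * z k (Sum.inl ()), fun k i => √(w k) • A k i,
    fun k => mul_nonneg (Real.sqrt_nonneg _) (hz0 k),
    fun k i => (hA k i).smul (Real.sqrt_nonneg _), ?_, fun i => ?_, fun i j => ?_⟩
  · have h1 := hentry (Sum.inl ()) (Sum.inl ())
    rw [show blockMatrix p (Sum.inl ()) (Sum.inl ()) = 1 from rfl] at h1
    rw [h1]
    exact Finset.sum_congr rfl fun k _ => by linear_combination z k (Sum.inl ()) ^ 2 * hs k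
  · ext a
    rw [show p.1 i a = _ from hentry (Sum.inl ()) (Sum.inr (i, a)), Finset.sum_apply]
    refine Finset.sum_congr rfl fun k _ => ?_
    rw [vec_smul, Pi.smul_apply, Pi.smul_apply, smul_eq_mul, smul_eq_mul, hvec]
    linear_combination -(z k (Sum.inl ()) * vec (A k i) a) * hs k
  · ext a b
    rw [show p.2 i j a b = _ from hentry (Sum.inr (i, a)) (Sum.inr (j, b)), Matrix.sum_apply]
    refine Finset.sum_congr rfl fun k _ => ?_
    rw [vecMulVec_apply, vec_smul, vec_smul, Pi.smul_apply, Pi.smul_apply, smul_eq_mul,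
      smul_eq_mul, hvec, hvec]
    linear_combination -(vec (A k i) a * vec (A k j) b) * hs k

/-- If the second moment `∑ k, x k ^ 2` equals `c ^ 2`, where `c = ∑ k, ζ k * x k` is the
first moment against weights with `∑ k, ζ k ^ 2 = 1`, then `x` is proportional to `ζ`: this is the
equality case of the Cauchy–Schwarz inequality. -/
theorem eq_mul_of_sum_sq_eq {ι : Type*} [Fintype ι] {ζ x : ι → ℝ} {c : ℝ}
    (hζ : ∑ k, ζ k ^ 2 = 1) (h1 : ∑ k, ζ k * x k = c) (h2 : ∑ k, x k ^ 2 = c ^ 2) (k : ι) :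
    x k = c * ζ k := by
  have h : ∑ k, (x k - c * ζ k) ^ 2 = 0 := by
    have : ∀ k, (x k - c * ζ k) ^ 2 = x k ^ 2 - 2 * c * (ζ k * x k) + c ^ 2 * ζ k ^ 2 :=
      fun k => by ring
    simp only [this, Finset.sum_add_distrib, Finset.sum_sub_distrib, ← Finset.mul_sum, hζ, h1, h2]
    ring
  have h0 := (Finset.sum_eq_zero_iff_of_nonneg fun k _ => sq_nonneg _).mp h k (Finset.mem_univ k)
  linarith [pow_eq_zero_iff (two_ne_zero) |>.mp h0]

theorem trace_vecMulVec_vec {m : Type*} [Fintype m] (A B : Matrix m m ℝ) :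
    (vecMulVec (vec A) (vec B)).trace = (Aᵀ * B).trace := by
  rw [trace_vecMulVec, vec_dotProduct_vec]

theorem vec_one_dotProduct_vec {m : Type*} [Fintype m] [DecidableEq m] (A : Matrix m m ℝ) :
    vec (1 : Matrix m m ℝ) ⬝ᵥ vec A = A.trace := by
  rw [vec_dotProduct_vec, transpose_one, Matrix.one_mul]

theorem frobInner_vecMulVec {m n : Type*} [Fintype m] [Fintype n] (M : Matrix m n ℝ) (x : m → ℝ)
    (y : n → ℝ) : frobInner M (vecMulVec x y) = x ⬝ᵥ M *ᵥ y := by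
  simp only [frobInner, dotProduct, mulVec, vecMulVec_apply, Finset.mul_sum]
  exact Finset.sum_congr rfl fun i _ => Finset.sum_congr rfl fun j _ => by ring

theorem frobInner_sum {m n ι : Type*} [Fintype m] [Fintype n] [Fintype ι] (M : Matrix m n ℝ)
    (Z : ι → Matrix m n ℝ) : frobInner M (∑ k, Z k) = ∑ k, frobInner M (Z k) := by
  simp only [frobInner, Matrix.sum_apply, Finset.mul_sum]
  rw [Finset.sum_comm (s := Finset.univ (α := ι))]
  exact Finset.sum_congr rfl fun i _ => Finset.sum_comm

theorem frobInner_vec_one {m : Type*} [Fintype m] [DecidableEq m] (A : Matrix m m ℝ) :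
    frobInner (vecMulVec (vec (1 : Matrix m m ℝ)) (vec (1 : Matrix m m ℝ)))
      (vecMulVec (vec A) (vec A)) = A.trace ^ 2 := by
  rw [frobInner_vecMulVec, vecMulVec_mulVec, vec_one_dotProduct_vec, dotProduct_smul,
    dotProduct_comm, vec_one_dotProduct_vec, sq]
  rfl

theorem trace_unvec_sum {m ι : Type*} [Fintype m] [Fintype ι] (ζ : ι → ℝ) (B : ι → Matrix m m ℝ) :
    (unvec (∑ k, ζ k • vec (B k))).trace = ∑ k, ζ k * (B k).trace := by
  have : unvec (∑ k, ζ k • vec (B k)) = ∑ k, ζ k • B k := by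
    apply vec_inj.mp
    rw [vec_unvec, vec_sum]
    rfl
  rw [this, trace_sum]
  simp only [trace_smul, smul_eq_mul]

/-- The constraints force each term of a decomposition with `ζ k > 0` to have a first component of
rank at most `r`. The moment constraints give `tr V = r ζ` and `V + T = ζ I` for the components
`(ζ, A, V, T)` of every term. The last constraint then says that the sum of the nonnegative
numbers `tr (A T)` is nonpositive, so that `T A = 0`, i.e. `V A = ζ A`. -/
theorem exists_decomposition_of_mem_cpFeasible {m : Type*} [Fintype m] [DecidableEq m] {r : ℕ}
    {p : LiftedVars m} (h : p ∈ cpFeasible m r) :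
    ∃ (ι : Type) (_ : Fintype ι) (ζ : ι → ℝ) (A : ι → Matrix m m ℝ),
      (∀ k, 0 ≤ ζ k) ∧ ∑ k, ζ k ^ 2 = 1 ∧ (∀ k, 0 < ζ k → FactorsThrough r (A k)) ∧
      p.1 0 = ∑ k, ζ k • vec (A k) ∧ p.2 0 0 = ∑ k, vecMulVec (vec (A k)) (vec (A k)) := by
  obtain ⟨htr1, htr2, hsum1, hsum2, hle, hcp⟩ := h
  obtain ⟨ι, _, ζ, B, hζ, hB, hζ1, hp1, hp2⟩ := exists_decomposition hcp
  refine ⟨ι, ‹_›, ζ, fun k => B k 0, hζ, hζ1, fun k hk => ?_, hp1 0, hp2 0 0⟩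
  have hV : ∀ k, (B k 1).trace = r * ζ k := by
    refine eq_mul_of_sum_sq_eq hζ1 ?_ ?_
    · rw [← trace_unvec_sum, ← hp1, htr1]
    · rw [← htr2, hp2, frobInner_sum]
      exact Finset.sum_congr rfl fun k _ => (frobInner_vec_one _).symm
  have hVT : ∀ k, B k 1 + B k 2 = ζ k • 1 := by
    intro k
    apply vec_inj.mp
    ext a
    rw [vec_smul, Pi.smul_apply, smul_eq_mul, mul_comm]
    refine eq_mul_of_sum_sq_eq (x := fun k => vec (B k 1 + B k 2) a) hζ1 ?_ ?_ k
    · rw [← hsum1, hp1, hp1, ← Finset.sum_add_distrib, Finset.sum_apply]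
      exact Finset.sum_congr rfl fun k _ => by simp [mul_add]
    · -- The entries of `vec 1` are `0` and `1`, so they agree with their squares.
      have hid : vec (1 : Matrix m m ℝ) a ^ 2 = vec (1 : Matrix m m ℝ) a := by
        rcases eq_or_ne a.2 a.1 with h | h <;> simp [vec, Matrix.one_apply, h]
      rw [hid, ← hsum2]
      simp only [hp2, ← Finset.sum_add_distrib, diag_apply, Matrix.sum_apply, Matrix.add_apply,
        vecMulVec_apply, vec_add, Pi.add_apply]
      exact Finset.sum_congr rfl fun k _ => by ring
  have hAT : ∀ k, (B k 0 * B k 2).trace = ζ k * (B k 0).trace - (B k 0 * B k 1).trace := by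
    intro k
    rw [eq_sub_of_add_eq' (hVT k), Matrix.mul_sub, trace_sub, Matrix.mul_smul, trace_smul,
      Matrix.mul_one, smul_eq_mul]
  have hnn : ∀ k, 0 ≤ (B k 0 * B k 2).trace := fun k =>
    (trace_mul_nonneg_and_mul_eq_zero (hB k 0) (hB k 2)).1
  have hzero : ∑ k, (B k 0 * B k 2).trace = 0 := by
    refine le_antisymm ?_ (Finset.sum_nonneg fun k _ => hnn k)
    rw [hp1, trace_unvec_sum, hp2, trace_sum, ← Finset.sum_sub_distrib] at hle
    refine le_trans (Finset.sum_le_sum fun k _ => ?_) hle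
    have hsymm : (B k 0)ᵀ = B k 0 := by simpa using (hB k 0).1.eq
    rw [hAT, trace_vecMulVec_vec, hsymm]
  have hk0 := (Finset.sum_eq_zero_iff_of_nonneg fun k _ => hnn k).mp hzero k (Finset.mem_univ k)
  have hTA := (trace_mul_nonneg_and_mul_eq_zero (hB k 0) (hB k 2)).2 hk0
  refine factorsThrough_of_mul_eq_smul (hB k 1) hk (hV k) ?_
  rw [eq_sub_of_add_eq (hVT k), Matrix.sub_mul, hTA, sub_zero, Matrix.smul_mul, Matrix.one_mul]

/-! ### The objective -/

theorem frobSq_eq_trace {m n : Type*} [Fintype m] [Fintype n] (M : Matrix m n ℝ) :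
    frobSq M = (Mᵀ * M).trace := by
  rw [← vec_dotProduct_vec, frobSq, Finset.sum_comm, dotProduct, Fintype.sum_prod_type]
  simp only [vec, sq]

theorem frobSq_nonneg {m n : Type*} [Fintype m] [Fintype n] (M : Matrix m n ℝ) : 0 ≤ frobSq M :=
  Finset.sum_nonneg fun _ _ => Finset.sum_nonneg fun _ _ => sq_nonneg _

theorem frobSq_smul {m n : Type*} [Fintype m] [Fintype n] (c : ℝ) (M : Matrix m n ℝ) :
    frobSq (c • M) = c ^ 2 * frobSq M := by
  simp only [frobSq, Matrix.smul_apply, smul_eq_mul, mul_pow, Finset.mul_sum]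

/-- The contribution of one rank-one term to the objective is a squared residual. The matrix
`P_uᵀ A P_v` is the off-diagonal block of `A`. -/
theorem objective_term {a b n : ℕ} (X : Matrix (Fin b) (Fin n) ℝ) (Y : Matrix (Fin a) (Fin n) ℝ)
    (ζ : ℝ) (A : Matrix (Fin a ⊕ Fin b) (Fin a ⊕ Fin b) ℝ) :
    frobInner ((selV a b * X * Xᵀ * (selV a b)ᵀ) ⊗ₖ (selU a b * (selU a b)ᵀ))
        (vecMulVec (vec A) (vec A))
      - 2 * (vec (selU a b * Y * Xᵀ * (selV a b)ᵀ) ⬝ᵥ ζ • vec A) + ζ ^ 2 * frobSq Y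
      = frobSq ((selU a b)ᵀ * A * selV a b * X - ζ • Y) := by
  set U := selU a b
  set V := selV a b
  have h1 : frobInner ((V * X * Xᵀ * Vᵀ) ⊗ₖ (U * Uᵀ)) (vecMulVec (vec A) (vec A)) =
      ((Uᵀ * A * V * X)ᵀ * (Uᵀ * A * V * X)).trace := by
    rw [frobInner_vecMulVec, kronecker_mulVec_vec, vec_dotProduct_vec]
    simp only [transpose_mul, transpose_transpose, Matrix.mul_assoc]
    rw [trace_mul_comm Xᵀ]
    simp only [Matrix.mul_assoc]
    rw [trace_mul_comm Vᵀ]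
    simp only [Matrix.mul_assoc]
  have h2 : vec (U * Y * Xᵀ * Vᵀ) ⬝ᵥ ζ • vec A = ζ * (Yᵀ * (Uᵀ * A * V * X)).trace := by
    rw [dotProduct_smul, vec_dotProduct_vec, smul_eq_mul]
    simp only [transpose_mul, transpose_transpose, Matrix.mul_assoc]
    rw [trace_mul_comm V]
    simp only [Matrix.mul_assoc]
    rw [trace_mul_comm X]
    simp only [Matrix.mul_assoc]
  have h3 : ((Uᵀ * A * V * X)ᵀ * Y).trace = (Yᵀ * (Uᵀ * A * V * X)).trace := by
    rw [← trace_transpose, transpose_mul, transpose_transpose]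
  rw [h1, h2, frobSq_eq_trace, frobSq_eq_trace, transpose_sub, Matrix.sub_mul, Matrix.mul_sub,
    Matrix.mul_sub, transpose_smul]
  simp only [trace_sub, Matrix.smul_mul, Matrix.mul_smul, trace_smul, smul_eq_mul, h3]
  ring

theorem cpObjective_eq_sum {a b n : ℕ} (X : Matrix (Fin b) (Fin n) ℝ)
    (Y : Matrix (Fin a) (Fin n) ℝ) {p : LiftedVars (Fin a ⊕ Fin b)} {ι : Type*} [Fintype ι]
    {ζ : ι → ℝ} {A : ι → Matrix (Fin a ⊕ Fin b) (Fin a ⊕ Fin b) ℝ} (hζ : ∑ k, ζ k ^ 2 = 1)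
    (h1 : p.1 0 = ∑ k, ζ k • vec (A k)) (h2 : p.2 0 0 = ∑ k, vecMulVec (vec (A k)) (vec (A k))) :
    cpObjective X Y p =
      1 / (2 * (n : ℝ)) * ∑ k, frobSq ((selU a b)ᵀ * A k * selV a b * X - ζ k • Y) := by
  simp only [← objective_term, Finset.sum_add_distrib, Finset.sum_sub_distrib, ← Finset.mul_sum,
    ← Finset.sum_mul, hζ, cpObjective, h1, h2, frobInner_sum, dotProduct_sum, one_mul]

/-! ### Comparing the two problems -/

/-- A matrix factoring through `ℝ ^ r` is the off-diagonal block of the semidefinite matrix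
`S * Sᵀ`, where `S` stacks the factors. -/
theorem exists_posSemidef_offDiagonal {a b r : ℕ} {M : Matrix (Fin a) (Fin b) ℝ}
    (h : FactorsThrough r M) : ∃ A : Matrix (Fin a ⊕ Fin b) (Fin a ⊕ Fin b) ℝ,
      A.PosSemidef ∧ A.rank ≤ r ∧ (selU a b)ᵀ * A * selV a b = M := by
  obtain ⟨L, R, rfl⟩ := h
  refine ⟨fromRows L Rᵀ * (fromRows L Rᵀ)ᴴ, posSemidef_self_mul_conjTranspose _,
    (rank_mul_le_left _ _).trans ((rank_le_card_width _).trans_eq (Fintype.card_fin r)), ?_⟩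
  rw [selU, selV, conjTranspose_eq_transpose_of_trivial, ← Matrix.mul_assoc, transpose_fromRows,
    transpose_fromRows, fromCols_mul_fromRows, Matrix.mul_assoc, fromCols_mul_fromRows]
  simp

/-- The rank-one point `z zᵀ` with `z = (1, vec A, vec V, vec (1 - V))`, where `V` is a projection
of rank `r` that fixes `A`. -/
theorem exists_mem_cpFeasible {m : Type*} [Fintype m] [DecidableEq m] {r : ℕ} {A : Matrix m m ℝ}
    (hA : A.PosSemidef) (hr : A.rank ≤ r) (hrm : r ≤ Fintype.card m) :
    ∃ p ∈ cpFeasible m r, p.1 0 = vec A ∧ p.2 0 0 = vecMulVec (vec A) (vec A) := by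
  obtain ⟨V, hV, hT, htr, hAV⟩ := exists_projection_of_rank_le hA hr hrm
  let B : Fin 3 → Matrix m m ℝ := ![A, V, 1 - V]
  have hB : ∀ i, (B i).PosSemidef := by
    intro i
    fin_cases i
    exacts [hA, hV, hT]
  let z : LiftedIndex m → ℝ := Sum.elim 1 fun x => vec (B x.1) x.2
  refine ⟨(fun i => vec (B i), fun i j => vecMulVec (vec (B i)) (vec (B j))),
    ⟨htr, ?_, ?_, ?_, ?_, subset_convexHull _ _ ⟨z, ⟨zero_le_one, fun i => ⟨B i, hB i, rfl⟩⟩, ?_⟩⟩,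
    rfl, rfl⟩
  · change frobInner _ (vecMulVec (vec V) (vec V)) = _
    rw [frobInner_vec_one, htr]
  · change vec V + vec (1 - V) = _
    rw [← vec_add, add_sub_cancel]
  · ext a
    change V a.2 a.1 * V a.2 a.1 + V a.2 a.1 * (1 - V) a.2 a.1 + (1 - V) a.2 a.1 * V a.2 a.1
      + (1 - V) a.2 a.1 * (1 - V) a.2 a.1 = (1 : Matrix m m ℝ) a.2 a.1
    rcases eq_or_ne a.2 a.1 with h | h <;> simp [Matrix.sub_apply, Matrix.one_apply, h]
    ring
  · change A.trace - (vecMulVec (vec A) (vec V)).trace ≤ 0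
    have hsymm : Aᵀ = A := by simpa using hA.1.eq
    rw [trace_vecMulVec_vec, hsymm, hAV, sub_self]
  · ext (x | x) (y | y)
    · change (1 : ℝ) = 1 * 1
      rw [mul_one]
    · exact (one_mul _).symm
    · exact (mul_one _).symm
    · rfl

/-- The completely positive program attains every training loss. -/
theorem exists_cpObjective_eq_trainingLoss {N n : ℕ} (d : ℕ → ℕ) (X : Matrix (Fin (d 0)) (Fin n) ℝ)
    (Y : Matrix (Fin (d N)) (Fin n) ℝ) (W : LayerWeights d N) :
    ∃ p ∈ cpFeasible (Fin (d N) ⊕ Fin (d 0)) (minWidth d N : ℝ),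
      cpObjective X Y p = trainingLoss d N X Y W := by
  obtain ⟨k, hk, h⟩ := exists_width_eq_minWidth d N
  obtain ⟨A, hA, hrank, hW⟩ := exists_posSemidef_offDiagonal
    (h ▸ factorsThrough_endToEnd d N W hk : FactorsThrough (minWidth d N) (endToEnd d N W))
  obtain ⟨p, hp, h1, h2⟩ := exists_mem_cpFeasible hA hrank (by
    simpa using (minWidth_le d (Nat.zero_le N)).trans (Nat.le_add_left _ _))
  refine ⟨p, hp, ?_⟩
  rw [cpObjective_eq_sum X Y (ι := Unit) (ζ := fun _ => 1) (A := fun _ => A) (by simp)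
    (by simpa using h1) (by simpa using h2)]
  simp [trainingLoss, hW]

/-- The objective at a feasible point is a sum of terms `ζ ^ 2 * ‖W X - Y‖²` with `W` realized by
the network and `∑ ζ ^ 2 = 1`, and of nonnegative terms with `ζ = 0`. -/
theorem le_cpObjective {N n : ℕ} (hN : 1 ≤ N) (d : ℕ → ℕ) (X : Matrix (Fin (d 0)) (Fin n) ℝ)
    (Y : Matrix (Fin (d N)) (Fin n) ℝ) {v : ℝ} (hv : ∀ W, v ≤ trainingLoss d N X Y W)
    {p : LiftedVars (Fin (d N) ⊕ Fin (d 0))}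
    (hp : p ∈ cpFeasible (Fin (d N) ⊕ Fin (d 0)) (minWidth d N : ℝ)) :
    v ≤ cpObjective X Y p := by
  obtain ⟨ι, _, ζ, A, hζ, hζ1, hA, h1, h2⟩ := exists_decomposition_of_mem_cpFeasible hp
  have hv1 : v = ∑ k, ζ k ^ 2 * v := by rw [← Finset.sum_mul, hζ1, one_mul]
  rw [cpObjective_eq_sum X Y hζ1 h1 h2, Finset.mul_sum, hv1]
  refine Finset.sum_le_sum fun k _ => ?_
  rcases (hζ k).eq_or_lt with h | h
  · rw [← h]
    have := frobSq_nonneg ((selU (d N) (d 0))ᵀ * A k * selV (d N) (d 0) * X - (0 : ℝ) • Y)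
    rw [zero_pow two_ne_zero, zero_mul]
    positivity
  · obtain ⟨W, hW⟩ : ∃ W, endToEnd d N W = (ζ k)⁻¹ • ((selU _ _)ᵀ * A k * selV _ _) :=
      exists_endToEnd_of_factorsThrough d hN ((((hA k h).mul_left _).mul_right _).smul _)
    have hres : (selU (d N) (d 0))ᵀ * A k * selV (d N) (d 0) * X - ζ k • Y =
        ζ k • (endToEnd d N W * X - Y) := by
      rw [hW, smul_sub, Matrix.smul_mul, smul_inv_smul₀ h.ne']
    rw [hres, frobSq_smul, mul_left_comm]
    exact mul_le_mul_of_nonneg_left (hv W) (sq_nonneg _)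

/-! ### Convexity -/

theorem blockMatrix_combo {m : Type*} (p q : LiftedVars m) {s t : ℝ} (h : s + t = 1) :
    blockMatrix (s • p + t • q) = s • blockMatrix p + t • blockMatrix q := by
  ext (x | x) (y | y)
  · exact (by simpa using h.symm : (1 : ℝ) = s * 1 + t * 1)
  all_goals rfl

theorem frobInner_combo {m n : Type*} [Fintype m] [Fintype n] (M A B : Matrix m n ℝ) (s t : ℝ) :
    frobInner M (s • A + t • B) = s * frobInner M A + t * frobInner M B := by
  simp only [frobInner, Finset.mul_sum, ← Finset.sum_add_distrib, Matrix.add_apply,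
    Matrix.smul_apply, smul_eq_mul]
  exact Finset.sum_congr rfl fun i _ => Finset.sum_congr rfl fun j _ => by ring

theorem convex_cpFeasible (m : Type*) [Fintype m] [DecidableEq m] (r : ℝ) :
    Convex ℝ (cpFeasible m r) := by
  intro p hp q hq s t hs ht hst
  obtain ⟨p1, p2, p3, p4, p5, p6⟩ := hp
  obtain ⟨q1, q2, q3, q4, q5, q6⟩ := hq
  have htr : ∀ i, (unvec ((s • p + t • q).1 i)).trace =
      s * (unvec (p.1 i)).trace + t * (unvec (q.1 i)).trace := fun i => by
    simp [unvec, trace, Finset.mul_sum, Finset.sum_add_distrib]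
  have hZ : ∀ i j, (s • p + t • q).2 i j = s • p.2 i j + t • q.2 i j := fun i j => rfl
  refine ⟨?_, ?_, ?_, ?_, ?_, ?_⟩
  · rw [htr, p1, q1, ← add_mul, hst, one_mul]
  · rw [hZ, frobInner_combo, p2, q2, ← add_mul, hst, one_mul]
  · calc (s • p + t • q).1 1 + (s • p + t • q).1 2
        = s • (p.1 1 + p.1 2) + t • (q.1 1 + q.1 2) := by
          ext a
          simp only [Prod.fst_add, Prod.smul_fst, Pi.add_apply, Pi.smul_apply, smul_eq_mul]
          ring
      _ = vec 1 := by rw [p3, q3, ← add_smul, hst, one_smul]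
  · rw [← one_smul ℝ (vec 1), ← hst, add_smul]
    nth_rw 1 [← p4]
    rw [← q4]
    ext a
    simp only [hZ, diag_apply, Matrix.add_apply, Matrix.smul_apply, Pi.add_apply, Pi.smul_apply,
      smul_eq_mul]
    ring
  · rw [htr, hZ, trace_add, trace_smul, trace_smul, smul_eq_mul, smul_eq_mul]
    nlinarith [mul_nonneg hs (neg_nonneg.mpr p5), mul_nonneg ht (neg_nonneg.mpr q5)]
  · rw [blockMatrix_combo p q hst]
    exact convex_convexHull ℝ _ p6 q6 hs ht hst

theorem cpObjective_affine {a b n : ℕ} (X : Matrix (Fin b) (Fin n) ℝ)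
    (Y : Matrix (Fin a) (Fin n) ℝ) :
    ∃ (L : LiftedVars (Fin a ⊕ Fin b) →ₗ[ℝ] ℝ) (c : ℝ), ∀ p, cpObjective X Y p = L p + c := by
  set M := (selV a b * X * Xᵀ * (selV a b)ᵀ) ⊗ₖ (selU a b * (selU a b)ᵀ)
  set u := vec (selU a b * Y * Xᵀ * (selV a b)ᵀ)
  refine ⟨
    { toFun := fun p => 1 / (2 * (n : ℝ)) * (frobInner M (p.2 0 0) - 2 * (u ⬝ᵥ p.1 0))
      map_add' := fun p q => ?_
      map_smul' := fun s p => ?_ }, 1 / (2 * (n : ℝ)) * frobSq Y, fun p => ?_⟩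
  · have h := frobInner_combo M (p.2 0 0) (q.2 0 0) 1 1
    simp only [one_smul, one_mul] at h
    simp only [Prod.fst_add, Prod.snd_add, Pi.add_apply, dotProduct_add, h]
    ring
  · have h := frobInner_combo M (p.2 0 0) 0 s 0
    simp only [zero_smul, zero_mul, add_zero] at h
    simp only [Prod.smul_fst, Prod.smul_snd, Pi.smul_apply, dotProduct_smul, h, smul_eq_mul,
      RingHom.id_apply]
    ring
  · simp only [cpObjective, LinearMap.coe_mk, AddHom.coe_mk]
    ring

theorem theorem1 (N n : ℕ) (hN : 1 ≤ N) (hn : 0 < n) (d : ℕ → ℕ)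
    (X : Matrix (Fin (d 0)) (Fin n) ℝ) (Y : Matrix (Fin (d N)) (Fin n) ℝ) :
    -- the two problems have the same (finite) optimal value
    (∃ v : ℝ,
      IsGLB (Set.range (trainingLoss d N X Y)) v ∧
      IsGLB (cpObjective X Y '' cpFeasible (Fin (d N) ⊕ Fin (d 0)) (minWidth d N : ℝ)) v) ∧
    -- the second one is a convex program: convex feasible set, affine objective
    Convex ℝ (cpFeasible (Fin (d N) ⊕ Fin (d 0)) (minWidth d N : ℝ)) ∧
    (∃ (L : LiftedVars (Fin (d N) ⊕ Fin (d 0)) →ₗ[ℝ] ℝ) (c : ℝ),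
      ∀ p, cpObjective X Y p = L p + c) ∧
    -- order of the block matrix
    Fintype.card (LiftedIndex (Fin (d N) ⊕ Fin (d 0))) = 1 + 3 * (d N + d 0) ^ 2 := by
  refine ⟨⟨sInf (Set.range (trainingLoss d N X Y)), ?_⟩, convex_cpFeasible _ _,
    cpObjective_affine X Y, ?_⟩
  · have hglb : IsGLB (Set.range (trainingLoss d N X Y)) (sInf (Set.range (trainingLoss d N X Y))) :=
      isGLB_csInf (Set.range_nonempty _) ⟨0, Set.forall_mem_range.mpr fun W =>
        mul_nonneg (by positivity) (frobSq_nonneg _)⟩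
    refine ⟨hglb, Set.forall_mem_image.mpr fun p hp => le_cpObjective hN d X Y
      (fun W => hglb.1 (Set.mem_range_self W)) hp, fun v hv => hglb.2 ?_⟩
    rintro _ ⟨W, rfl⟩
    obtain ⟨p, hp, h⟩ := exists_cpObjective_eq_trainingLoss d X Y W
    exact h ▸ hv (Set.mem_image_of_mem _ hp)
  · simp only [Fintype.card_sum, Fintype.card_prod, Fintype.card_fin, Fintype.card_unit]
    ring
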